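/- For a group $F$ let $U_F$ be the free group with basis $\{u_g : g\in F,\ g\neq 1\}$, put $u_1=1$, and let $J_F$ be the kernel of the projection $U_F\to F$, $u_g\mapsto g$. For a normal subgroup $N$ of $F$ let $U_{N,F}$ be the kernel of the map $U_F\to U_{F/N}$, $u_g\mapsto u_{gN}$, let $J_{N,F}=U_{N,F}\cap J_F$, and let $$K^J_2(N,F)=\frac{J_{N,F}\cap[U_{N,F},U_F]}{[J_{N,F},U_F]\,[U_{N,F},J_F]},$$ which is an abelian group. Lemma 17. Let $C\subseteq B$ be a central subgroup of a group $B$, and write $B^{ab}=B/[B,B]$. Then there is a surjective homomorphism $$C\otimes_{\mathbb Z} B^{ab}\twoheadrightarrow K^J_2(C,B),\qquad c\otimes \bar b\mapsto \text{the class of } [u_c,u_b],$$ whose kernel is the subgroup generated by the elements $c\otimes\bar c$, $c\in C$, where $\bar b$ is the image of $b\in B$ in $B^{ab}$. Moreover $K^J_2(C,B)$ is an extension of $C\otimes_{\mathbb Z}(B/C)^{ab}$: there is a surjective homomorphism $K^J_2(C,B)\twoheadrightarrow C\otimes_{\mathbb Z}(B/C)^{ab}$ that sends the class of $[u_c,u_b]$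 to $c\otimes\overline{bC}$ for all $c\in C$, $b\in B$, where $\overline{bC}$ is the image of $bC$ in $(B/C)^{ab}$. -/

import Mathlib

open scoped TensorProduct commutatorElement

noncomputable section

namespace KJ

universe v w

/-- `U_F`: the free group with basis `u_g`, `g` a nontrivial element of the group `F`. -/
abbrev U (F : Type v) [Group F] : Type v := FreeGroup {g : F // g ≠ 1}

open Classical in
/-- The canonical element `u_g` of `U_F`, with the convention `u_1 = 1`. -/
def u {F : Type v} [Group F] (g : F) : U F :=
  if h : g = 1 then 1 else FreeGroup.of ⟨g, h⟩

/-- The canonical projection `U_F → F`, `u_g ↦ g`. -/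
def proj (F : Type v) [Group F] : U F →* F :=
  FreeGroup.lift fun g => (g : F)

/-- The homomorphism `U_F → U_G`, `u_g ↦ u_{f g}`, induced by a homomorphism `f : F → G`. -/
def mapU {F : Type v} {G : Type w} [Group F] [Group G] (f : F →* G) : U F →* U G :=
  FreeGroup.lift fun g => u (f (g : F))

@[simp]
theorem u_one {F : Type v} [Group F] : u (1 : F) = 1 := by
  simp [u]

@[simp]
theorem proj_u {F : Type v} [Group F] (g : F) : proj F (u g) = g := by
  by_cases h : g = 1
  · simp [h]
  · simp [u, h, proj]

@[simp]
theorem mapU_u {F : Type v} {G : Type w} [Group F] [Group G] (f : F →* G) (g : F) :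
    mapU f (u g) = u (f g) := by
  by_cases h : g = 1
  · simp [h]
  · simp [u, h, mapU]

variable {F : Type v} [Group F]

/-- `J_F`, the kernel of `U_F → F`. -/
def J (F : Type v) [Group F] : Subgroup (U F) := (proj F).ker

/-- `U_{N,F}`, the kernel of `U_F → U_{F/N}`. -/
def URel (N : Subgroup F) [N.Normal] : Subgroup (U F) := (mapU (QuotientGroup.mk' N)).ker

/-- `J_{N,F}`, the kernel of `U_{N,F} → N`, that is `U_{N,F} ∩ J_F`. -/
def JRel (N : Subgroup F) [N.Normal] : Subgroup (U F) := URel N ⊓ J F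

/-- `J_{N,F} ∩ [U_{N,F}, U_F]`. -/
def cycles (N : Subgroup F) [N.Normal] : Subgroup (U F) :=
  JRel N ⊓ ⁅URel N, (⊤ : Subgroup (U F))⁆

/-- `[J_{N,F}, U_F] + [U_{N,F}, J_F]`. -/
def boundaries (N : Subgroup F) [N.Normal] : Subgroup (U F) :=
  ⁅JRel N, (⊤ : Subgroup (U F))⁆ ⊔ ⁅URel N, J F⁆

instance normal_J : (J F).Normal := by unfold J; infer_instance

instance normal_URel (N : Subgroup F) [N.Normal] : (URel N).Normal := by
  unfold URel; infer_instance

instance normal_JRel (N : Subgroup F) [N.Normal] : (JRel N).Normal := by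
  unfold JRel; infer_instance

instance normal_boundaries (N : Subgroup F) [N.Normal] : (boundaries N).Normal := by
  unfold boundaries; infer_instance

/-- The subgroup divided out below is all of `boundaries N`. -/
theorem boundaries_le_cycles (N : Subgroup F) [N.Normal] : boundaries N ≤ cycles N := by
  refine sup_le (le_inf ?_ ?_) (le_inf (le_inf ?_ ?_) ?_)
  · exact Subgroup.commutator_le_left _ _
  · exact Subgroup.commutator_mono inf_le_left le_rfl
  · exact Subgroup.commutator_le_left _ _
  · exact Subgroup.commutator_le_right _ _
  · exact Subgroup.commutator_mono le_rfl le_top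

/-- `K^J_2(N, F) = (J_{N,F} ∩ [U_{N,F}, U_F]) / ([J_{N,F}, U_F] + [U_{N,F}, J_F])`. -/
abbrev K2 (N : Subgroup F) [N.Normal] : Type v :=
  cycles N ⧸ (boundaries N).subgroupOf (cycles N)

instance commGroup_K2 (N : Subgroup F) [N.Normal] : CommGroup (K2 N) :=
  { (inferInstance : Group (K2 N)) with
    mul_comm := by
      intro a b
      obtain ⟨x, rfl⟩ := QuotientGroup.mk_surjective a
      obtain ⟨y, rfl⟩ := QuotientGroup.mk_surjective b
      have h : ⁅y⁻¹, x⁻¹⁆ ∈ (boundaries N).subgroupOf (cycles N) :=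
        Subgroup.mem_subgroupOf.2 (Subgroup.mem_sup_left
          (Subgroup.commutator_mem_commutator (y⁻¹).2.1 (Subgroup.mem_top _)))
      refine QuotientGroup.eq.2 ?_
      simpa [commutatorElement_def, mul_assoc] using h }

/-- A central subgroup is normal. -/
theorem normal_of_central {C : Subgroup F} (hC : C ≤ Subgroup.center F) : C.Normal :=
  ⟨fun c hc g => by
    rw [Subgroup.mem_center_iff.1 (hC hc) g, mul_inv_cancel_right]; exact hc⟩

/-- A central subgroup is an abelian group (with its subgroup structure). -/
abbrev commGroupOfCentral {C : Subgroup F} (hC : C ≤ Subgroup.center F) : CommGroup C :=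
  { (inferInstance : Group C) with
    mul_comm := fun a b => Subtype.ext (Subgroup.mem_center_iff.1 (hC b.2) a) }

theorem commutator_mem_cycles {C : Subgroup F} [C.Normal] (hC : C ≤ Subgroup.center F)
    (c : C) (b : F) : ⁅u (c : F), u b⁆ ∈ cycles C := by
  have hc : u (c : F) ∈ URel C := by
    have h : (QuotientGroup.mk' C) (c : F) = 1 := (QuotientGroup.eq_one_iff _).2 c.2
    rw [URel, MonoidHom.mem_ker, mapU_u, h, u_one]
  have h1 : ⁅u (c : F), u b⁆ ∈ ⁅URel C, (⊤ : Subgroup (U F))⁆ :=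
    Subgroup.commutator_mem_commutator hc (Subgroup.mem_top _)
  refine ⟨⟨Subgroup.commutator_le_left _ _ h1, ?_⟩, h1⟩
  change proj F _ = 1
  rw [map_commutatorElement, proj_u, proj_u, commutatorElement_eq_one_iff_mul_comm]
  exact (Subgroup.mem_center_iff.1 (hC c.2) b).symm

/-- For a central subgroup `C` of `F`, the class of `[u_c, u_b]` in `K^J_2(C, F)`. -/
def symbol {C : Subgroup F} [C.Normal] (hC : C ≤ Subgroup.center F) (c : C) (b : F) : K2 C :=
  QuotientGroup.mk (⟨⁅u (c : F), u b⁆, commutator_mem_cycles hC c b⟩ : cycles C)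

end KJ

end

/-!
Since `C` is central, `[U_{C,B}, U_B]` lies in `J_{C,B}`, which is central modulo
`[J_{C,B}, U_B]`. Hence the class of `[v, x]` in `K^J_2(C, B)` is bimultiplicative in
`v ∈ U_{C,B}` and `x ∈ U_B`, and depends only on the images of `v` and `x` in `B`. So the symbols
`[u_c, u_b]` are bimultiplicative, satisfy `[u_c, u_c] = 1` and generate.

Everything else follows from the universal property: every bimultiplicative `t : C × B → M` with
`t(c, c) = 1` factors through the symbol. Lifting `U_{B/C} → B/C` to `B` yields a homomorphism
`ρ : U_B → B` trivial on `U_{C,B}`, and the image of `x` in `B` is `x̄ = κ(x) ρ(x)` with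
`κ : U_B → C` a homomorphism. Then `T(x, y) = t(κ x, ȳ) / t(κ y, ρ x)` is alternating on all of
`U_B`, and equals `t(x̄, ȳ)` when `x ∈ U_{C,B}`. An alternating map `T` on a free group comes from
a homomorphism on its commutator subgroup, `[x, y] ↦ T(x, y)`: write `T(x, y) = β(x, y) / β(y, x)`
with `β` bimultiplicative; the 2-cocycle `β` is trivial on a free group, so
`q(xy) = q(x) q(y) β(x, y)` for some function `q`, which restricts to that homomorphism.
-/

namespace KJ

section FreeGroup

variable {G M X : Type*} [Group G] [CommGroup M]

/-- The central extension of `G` by `M` whose 2-cocycle is the bimultiplicative map `β`, on the set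
`G × M`. Its splitting over a free group trivializes the cocycle `β`. -/
@[ext]
structure CentralExtension (β : G →* G →* M) where
  base : G
  fiber : M

namespace CentralExtension

variable {β : G →* G →* M}

instance : Mul (CentralExtension β) :=
  ⟨fun x y => ⟨x.base * y.base, x.fiber * y.fiber * β x.base y.base⟩⟩

instance : One (CentralExtension β) := ⟨⟨1, 1⟩⟩

instance : Inv (CentralExtension β) :=
  ⟨fun x => ⟨x.base⁻¹, x.fiber⁻¹ * β x.base x.base⟩⟩

@[simp] theorem base_mul (x y : CentralExtension β) : (x * y).base = x.base * y.base := rfl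

@[simp] theorem fiber_mul (x y : CentralExtension β) :
    (x * y).fiber = x.fiber * y.fiber * β x.base y.base := rfl

@[simp] theorem base_one : (1 : CentralExtension β).base = 1 := rfl

@[simp] theorem fiber_one : (1 : CentralExtension β).fiber = 1 := rfl

@[simp] theorem base_inv (x : CentralExtension β) : x⁻¹.base = x.base⁻¹ := rfl

@[simp] theorem fiber_inv (x : CentralExtension β) :
    x⁻¹.fiber = x.fiber⁻¹ * β x.base x.base := rfl

instance : Group (CentralExtension β) :=
  Group.ofLeftAxioms
    (fun x y z => by
      ext
      · simp only [base_mul, mul_assoc]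
      · simp only [base_mul, fiber_mul, map_mul, MonoidHom.mul_apply, mul_assoc,
          mul_comm, mul_left_comm])
    (fun x => by ext <;> simp)
    (fun x => by ext <;> simp)

/-- The projection of the central extension onto its quotient. -/
def baseHom (β : G →* G →* M) : CentralExtension β →* G where
  toFun := base
  map_one' := rfl
  map_mul' _ _ := rfl

end CentralExtension

theorem exists_map_mul_eq_mul_mul_bimul (β : FreeGroup X →* FreeGroup X →* M) :
    ∃ q : FreeGroup X → M, ∀ x y, q (x * y) = q x * q y * β x y := by
  let σ : FreeGroup X →* CentralExtension β := FreeGroup.lift fun a => ⟨FreeGroup.of a, 1⟩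
  have base_σ (x) : (σ x).base = x := by
    have h : (CentralExtension.baseHom β).comp σ = MonoidHom.id _ := by
      ext a
      simp [σ, CentralExtension.baseHom]
    exact DFunLike.congr_fun h x
  refine ⟨fun x => (σ x).fiber, fun x y => ?_⟩
  simp only [map_mul, CentralExtension.fiber_mul, base_σ]

theorem mul_swap_eq_one_of_alternating (T : G →* G →* M) (hT : ∀ x, T x x = 1) (x y : G) :
    T x y * T y x = 1 := by
  simpa [hT, mul_comm] using hT (x * y)

theorem exists_div_swap_eq_of_alternating (T : FreeGroup X →* FreeGroup X →* M)
    (hT : ∀ x, T x x = 1) :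
    ∃ β : FreeGroup X →* FreeGroup X →* M, ∀ x y, β x y / β y x = T x y := by
  classical
  -- `β` is the part of the Gram matrix of `T` above the diagonal, for some order of the basis.
  let β : FreeGroup X →* FreeGroup X →* M := FreeGroup.lift fun a => FreeGroup.lift fun b =>
    if WellOrderingRel a b then T (FreeGroup.of a) (FreeGroup.of b) else 1
  have h : β / β.flip = T := by
    ext a b
    simp only [MonoidHom.div_apply, MonoidHom.flip_apply, β, FreeGroup.lift_apply_of]
    rcases trichotomous_of WellOrderingRel a b with hab | rfl | hba
    · simp [hab, asymm_of WellOrderingRel hab]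
    · simp [hT]
    · simp only [hba, asymm_of WellOrderingRel hba, if_true, if_false, one_div]
      exact (eq_inv_of_mul_eq_one_left (mul_swap_eq_one_of_alternating T hT _ _)).symm
  exact ⟨β, fun x y => DFunLike.congr_fun (DFunLike.congr_fun h x) y⟩

theorem exists_commutator_hom_of_alternating (T : FreeGroup X →* FreeGroup X →* M)
    (hT : ∀ x, T x x = 1) :
    ∃ τ : commutator (FreeGroup X) →* M, ∀ x y,
      τ ⟨⁅x, y⁆, Subgroup.commutator_mem_commutator (Subgroup.mem_top x) (Subgroup.mem_top y)⟩ =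
        T x y := by
  obtain ⟨β, hβ⟩ := exists_div_swap_eq_of_alternating T hT
  obtain ⟨q, hq⟩ := exists_map_mul_eq_mul_mul_bimul β
  have q_mul {z} (hz : z ∈ commutator (FreeGroup X)) (x) : q (z * x) = q z * q x := by
    have hβz : β z = 1 := Abelianization.commutator_subset_ker β hz
    rw [hq, hβz, MonoidHom.one_apply, mul_one]
  refine ⟨MonoidHom.mk' (fun z => q z) fun z w => q_mul z.2 w, fun x y => ?_⟩
  have hxy : ⁅x, y⁆ ∈ commutator (FreeGroup X) :=
    Subgroup.commutator_mem_commutator (Subgroup.mem_top x) (Subgroup.mem_top y)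
  calc q ⁅x, y⁆ = q (⁅x, y⁆ * (y * x)) / q (y * x) := by rw [q_mul hxy, mul_div_cancel_right]
    _ = q (x * y) / q (y * x) := by simp [commutatorElement_def, mul_assoc]
    _ = β x y / β y x := by rw [hq, hq, mul_comm (q y), mul_div_mul_left_eq_div]
    _ = T x y := hβ x y

end FreeGroup

section Tensor

variable {C B M : Type*} [CommGroup C] [Group B] [CommGroup M]

theorem addSubgroup_eq_top_of_tmul_mem
    {S : AddSubgroup (Additive C ⊗[ℤ] Additive (Abelianization B))}
    (hS : ∀ (c : C) (b : B), Additive.ofMul c ⊗ₜ Additive.ofMul (Abelianization.of b) ∈ S) :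
    S = ⊤ := by
  refine eq_top_iff.2 fun x _ => ?_
  induction x using TensorProduct.induction_on with
  | zero => exact zero_mem S
  | add x y hx hy => exact add_mem (hx trivial) (hy trivial)
  | tmul c x =>
    obtain ⟨b, rfl⟩ := QuotientGroup.mk_surjective x
    exact hS c b

variable (C B) in
/-- The universal bimultiplicative map `(c, b) ↦ c ⊗ b̄` on `C × B`, with values in
`C ⊗ B^ab` written multiplicatively. -/
def tmulHom : C →* B →* Multiplicative (Additive C ⊗[ℤ] Additive (Abelianization B)) :=
  MonoidHom.mk' (fun c => MonoidHom.mk'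
    (fun b => .ofAdd (.ofMul c ⊗ₜ .ofMul (Abelianization.of b)))
    fun b b' => by rw [map_mul, ofMul_mul, TensorProduct.tmul_add, ofAdd_add])
    fun c c' => by
      ext b
      exact congrArg Multiplicative.ofAdd (TensorProduct.add_tmul _ _ _)

/-- The homomorphism `C ⊗ B^ab → M`, `c ⊗ b̄ ↦ s c b`, induced by a bimultiplicative map `s`. -/
def tensorLift (s : C →* B →* M) :
    Additive C ⊗[ℤ] Additive (Abelianization B) →+ Additive M :=
  TensorProduct.liftAddHom
    (AddMonoidHom.mk' (fun c => (Abelianization.lift (s c.toMul)).toAdditive)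
      fun c c' => by
        ext b
        simp)
    fun n c x => by rw [map_zsmul, map_zsmul, AddMonoidHom.zsmul_apply]

theorem tensorLift_tmul (s : C →* B →* M) (c : C) (b : B) :
    tensorLift s (.ofMul c ⊗ₜ .ofMul (Abelianization.of b)) = .ofMul (s c b) := rfl

theorem tensorLift_surjective {s : C →* B →* M}
    (hs : Subgroup.closure {m | ∃ c b, s c b = m} = ⊤) : Function.Surjective (tensorLift s) := by
  have h : Subgroup.closure {m | ∃ c b, s c b = m} ≤ (tensorLift s).range.toSubgroup' := by
    rw [Subgroup.closure_le]
    rintro _ ⟨c, b, rfl⟩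
    exact ⟨_, tensorLift_tmul s c b⟩
  exact fun m => (hs ▸ h) (Subgroup.mem_top m.toMul)

theorem ker_tensorLift {s : C →* B →* M}
    {R : AddSubgroup (Additive C ⊗[ℤ] Additive (Abelianization B))} (hR : R ≤ (tensorLift s).ker)
    (f : M →* Multiplicative (Additive C ⊗[ℤ] Additive (Abelianization B) ⧸ R))
    (hf : ∀ c b, f (s c b) = .ofAdd ↑(tmulHom C B c b).toAdd) :
    (tensorLift s).ker = R := by
  refine le_antisymm (fun x hx => ?_) hR
  have h : (f.toAdditiveLeft.comp (tensorLift s)).eqLocus (QuotientAddGroup.mk' R) = ⊤ :=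
    addSubgroup_eq_top_of_tmul_mem hf
  have hx' : f.toAdditiveLeft (tensorLift s x) = QuotientAddGroup.mk' R x :=
    h.ge (AddSubgroup.mem_top x)
  rw [← QuotientAddGroup.ker_mk' R, AddMonoidHom.mem_ker, ← hx', hx, map_zero]

end Tensor

section K2

variable {B : Type*} [Group B]

theorem monoidHom_ext_u {G : Type*} [Monoid G] {f g : U B →* G} (h : ∀ b, f (u b) = g (u b)) :
    f = g := by
  ext b
  simpa [u, b.2] using h b

theorem proj_comp_mapU {Q : Type*} [Group Q] (f : B →* Q) :
    (proj Q).comp (mapU f) = f.comp (proj B) :=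
  monoidHom_ext_u fun b => by simp

theorem exists_comp_eq_proj {Q : Type*} [Group Q] {f : B →* Q} (hf : Function.Surjective f) :
    ∃ σ : U Q →* B, f.comp σ = proj Q :=
  ⟨FreeGroup.lift fun g => Function.surjInv hf g, by
    ext g
    simp [proj, Function.surjInv_eq hf]⟩

section Normal

variable {N : Subgroup B} [N.Normal]

theorem u_mem_URel {b : B} (hb : b ∈ N) : u b ∈ URel N := by
  rw [URel, MonoidHom.mem_ker, mapU_u, QuotientGroup.mk'_apply, (QuotientGroup.eq_one_iff b).2 hb,
    u_one]

theorem proj_mem_of_mem_URel {v : U B} (hv : v ∈ URel N) : proj B v ∈ N := by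
  have h := DFunLike.congr_fun (proj_comp_mapU (QuotientGroup.mk' N)) v
  rw [MonoidHom.comp_apply, MonoidHom.mem_ker.1 hv, map_one] at h
  exact (QuotientGroup.eq_one_iff _).1 h.symm

theorem exists_hom_div_mem (N : Subgroup B) [N.Normal] :
    ∃ ρ : U B →* B, (∀ v ∈ URel N, ρ v = 1) ∧ ∀ x, proj B x / ρ x ∈ N := by
  obtain ⟨σ, hσ⟩ := exists_comp_eq_proj (QuotientGroup.mk'_surjective N)
  refine ⟨σ.comp (mapU (QuotientGroup.mk' N)), fun v hv => ?_, fun x => ?_⟩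
  · rw [MonoidHom.comp_apply, MonoidHom.mem_ker.1 hv, map_one]
  · rw [← QuotientGroup.eq_iff_div_mem]
    have h : (QuotientGroup.mk' N).comp (σ.comp (mapU (QuotientGroup.mk' N))) =
        (QuotientGroup.mk' N).comp (proj B) := by
      rw [← MonoidHom.comp_assoc, hσ, proj_comp_mapU]
    exact (DFunLike.congr_fun h x).symm

theorem K2_mk_eq_mk_iff {x y : cycles N} :
    (QuotientGroup.mk x : K2 N) = QuotientGroup.mk y ↔ (x / y : U B) ∈ boundaries N :=
  QuotientGroup.eq_iff_div_mem

theorem commutator_mem_boundaries_of_mem_JRel {z : U B} (hz : z ∈ JRel N) (x : U B) :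
    ⁅x, z⁆ ∈ boundaries N := by
  refine Subgroup.mem_sup_left ?_
  rw [Subgroup.commutator_comm]
  exact Subgroup.commutator_mem_commutator (Subgroup.mem_top x) hz

theorem commutator_mul_left_div_mem {w x : U B} (h : ⁅w, x⁆ ∈ JRel N) (v : U B) :
    ⁅v * w, x⁆ / (⁅w, x⁆ * ⁅v, x⁆) ∈ boundaries N := by
  rw [commutatorElement_mul_left_eq_conj_mul, mul_div_mul_right_eq_div, div_eq_mul_inv]
  exact commutator_mem_boundaries_of_mem_JRel h v

theorem commutator_mul_right_div_mem {v y : U B} (h : ⁅v, y⁆ ∈ JRel N) (x : U B) :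
    ⁅v, x * y⁆ / (⁅v, x⁆ * ⁅v, y⁆) ∈ boundaries N := by
  have h_eq : ⁅v, x * y⁆ / (⁅v, x⁆ * ⁅v, y⁆) = ⁅v, x⁆ * ⁅x, ⁅v, y⁆⁆ * ⁅v, x⁆⁻¹ := by
    rw [commutatorElement_mul_right_eq_mul_conj, commutatorElement_def x]
    simp only [div_eq_mul_inv, mul_inv_rev, mul_assoc]
  rw [h_eq]
  exact (normal_boundaries N).conj_mem _ (commutator_mem_boundaries_of_mem_JRel h x) _

end Normal

section Central

variable {C : Subgroup B} (hC : C ≤ Subgroup.center B)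

include hC

theorem exists_hom_coe_eq_div {G : Type*} [Group G] (f g : G →* B) (h : ∀ x, f x / g x ∈ C) :
    ∃ κ : G →* C, ∀ x, (κ x : B) = f x / g x := by
  refine ⟨MonoidHom.mk' (fun x => ⟨f x / g x, h x⟩) fun x y => Subtype.ext ?_, fun _ => rfl⟩
  have hy := Subgroup.mem_center_iff.1 (hC (h y))
  calc f (x * y) / g (x * y) = f x * (f y / g y) / g x := by
        simp only [map_mul, div_eq_mul_inv, mul_inv_rev, mul_assoc]
    _ = f y / g y * (f x / g x) := by rw [hy, mul_div_assoc]
    _ = f x / g x * (f y / g y) := (hy _).symm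

variable [C.Normal]

theorem exists_alternating_pullback {M : Type*} [CommGroup M] (t : C →* B →* M)
    (ht : ∀ c : C, t c c = 1) :
    ∃ T : U B →* U B →* M, (∀ x, T x x = 1) ∧
      ∀ v (hv : v ∈ URel C) x, T v x = t ⟨proj B v, proj_mem_of_mem_URel hv⟩ (proj B x) := by
  obtain ⟨ρ, hρ, hρ_mem⟩ := exists_hom_div_mem C
  obtain ⟨κ, hκ⟩ := exists_hom_coe_eq_div hC (proj B) ρ hρ_mem
  refine ⟨(t.comp κ).compl₂ (proj B) / ((t.comp κ).compl₂ ρ).flip, fun x => ?_, fun v hv x => ?_⟩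
  · change t (κ x) (proj B x) / t (κ x) (ρ x) = 1
    rw [← map_div, ← hκ, ht]
  · have hκv : κ v = ⟨proj B v, proj_mem_of_mem_URel hv⟩ :=
      Subtype.ext (by rw [hκ, hρ v hv, div_one])
    change t (κ v) (proj B x) / t (κ x) (ρ v) = _
    rw [hρ v hv, map_one, div_one, hκv]

theorem exists_hom_symbol_eq {M : Type*} [CommGroup M] (t : C →* B →* M) (ht : ∀ c : C, t c c = 1) :
    ∃ f : K2 C →* M, ∀ c b, f (symbol hC c b) = t c b := by
  obtain ⟨T, hT, hTt⟩ := exists_alternating_pullback hC t ht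
  obtain ⟨τ, hτ⟩ := exists_commutator_hom_of_alternating T hT
  have hle : cycles C ≤ commutator (U B) :=
    inf_le_right.trans (Subgroup.commutator_mono le_top le_rfl)
  have boundaries_le : boundaries C ≤ τ.ker.map (commutator (U B)).subtype := by
    refine sup_le (Subgroup.commutator_le.2 fun v hv x _ => ?_)
      (Subgroup.commutator_le.2 fun v hv x hx => ?_)
    · refine ⟨_, (hτ v x).trans ?_, rfl⟩
      have hv₁ : (⟨proj B v, proj_mem_of_mem_URel hv.1⟩ : C) = 1 := Subtype.ext hv.2
      rw [hTt v hv.1, hv₁, map_one, MonoidHom.one_apply]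
    · refine ⟨_, (hτ v x).trans ?_, rfl⟩
      rw [hTt v hv, MonoidHom.mem_ker.1 hx, map_one]
  refine ⟨QuotientGroup.lift _ (τ.comp (Subgroup.inclusion hle)) fun z hz => ?_, fun c b => ?_⟩
  · obtain ⟨w, hw, hwz⟩ := boundaries_le (Subgroup.mem_subgroupOf.1 hz)
    obtain rfl : w = Subgroup.inclusion hle z := Subtype.ext hwz
    exact hw
  · refine (hτ (u c) (u b)).trans ?_
    simp [hTt _ (u_mem_URel c.2)]

theorem commutator_URel_le_cycles : ⁅URel C, (⊤ : Subgroup (U B))⁆ ≤ cycles C := by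
  refine le_inf (le_inf (Subgroup.commutator_le_left _ _) ?_) le_rfl
  refine Subgroup.commutator_le.2 fun v hv x _ => ?_
  rw [J, MonoidHom.mem_ker, map_commutatorElement, commutatorElement_eq_one_iff_mul_comm]
  exact (Subgroup.mem_center_iff.1 (hC (proj_mem_of_mem_URel hv)) _).symm

theorem commutator_mem_cycles_of_mem_URel {v : U B} (hv : v ∈ URel C) (x : U B) :
    ⁅v, x⁆ ∈ cycles C :=
  commutator_URel_le_cycles hC (Subgroup.commutator_mem_commutator hv (Subgroup.mem_top x))

/-- The class of `[v, x]` in `K^J_2(C, B)` for arbitrary `v ∈ U_{C,B}` and `x ∈ U_B`, as a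
bimultiplicative map. -/
noncomputable def commutatorClass : URel C →* U B →* K2 C :=
  MonoidHom.mk'
    (fun v => MonoidHom.mk'
      (fun x => QuotientGroup.mk ⟨⁅(v : U B), x⁆, commutator_mem_cycles_of_mem_URel hC v.2 x⟩)
      fun x y => K2_mk_eq_mk_iff.2
        (commutator_mul_right_div_mem (commutator_mem_cycles_of_mem_URel hC v.2 y).1 x))
    fun v w => MonoidHom.ext fun x => by
      rw [MonoidHom.mul_apply, mul_comm]
      exact K2_mk_eq_mk_iff.2
        (commutator_mul_left_div_mem (commutator_mem_cycles_of_mem_URel hC w.2 x).1 v)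

theorem commutatorClass_eq_one_iff {v : URel C} {x : U B} :
    commutatorClass hC v x = 1 ↔ ⁅(v : U B), x⁆ ∈ boundaries C :=
  (QuotientGroup.eq_one_iff _).trans Subgroup.mem_subgroupOf

theorem commutatorClass_eq_symbol {v : URel C} {x : U B} {c : C} {b : B} (hv : proj B v = c)
    (hx : proj B x = b) : commutatorClass hC v x = symbol hC c b := by
  let v' : URel C := ⟨u c, u_mem_URel c.2⟩
  have h_left : commutatorClass hC v x = commutatorClass hC v' x := by
    rw [← div_eq_one, ← MonoidHom.div_apply, ← map_div, commutatorClass_eq_one_iff]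
    have hmem : ((v / v' : URel C) : U B) ∈ J B := by simp [J, MonoidHom.mem_ker, v', hv]
    exact Subgroup.mem_sup_left
      (Subgroup.commutator_mem_commutator ⟨(v / v').2, hmem⟩ (Subgroup.mem_top x))
  have h_right : commutatorClass hC v' x = commutatorClass hC v' (u b) := by
    rw [← div_eq_one, ← map_div, commutatorClass_eq_one_iff]
    have hmem : x / u b ∈ J B := by simp [J, MonoidHom.mem_ker, hx]
    exact Subgroup.mem_sup_right (Subgroup.commutator_mem_commutator v'.2 hmem)
  exact h_left.trans h_right

theorem symbol_mul_left (c c' : C) (b : B) :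
    symbol hC (c * c') b = symbol hC c b * symbol hC c' b := by
  let v (c : C) : URel C := ⟨u (c : B), u_mem_URel c.2⟩
  have h : symbol hC (c * c') b = commutatorClass hC (v c * v c') (u b) :=
    (commutatorClass_eq_symbol hC (by simp [v]) (proj_u b)).symm
  rw [h, map_mul]
  rfl

theorem symbol_mul_right (c : C) (b b' : B) :
    symbol hC c (b * b') = symbol hC c b * symbol hC c b' := by
  let v : URel C := ⟨u (c : B), u_mem_URel c.2⟩
  have h : symbol hC c (b * b') = commutatorClass hC v (u b * u b') :=
    (commutatorClass_eq_symbol hC (proj_u _) (by simp)).symm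
  exact h.trans (map_mul _ _ _)

theorem symbol_self (c : C) : symbol hC c c = 1 := by
  rw [symbol, QuotientGroup.eq_one_iff, Subgroup.mem_subgroupOf]
  simp only [commutatorElement_self, one_mem]

/-- The symbol `(c, b) ↦ [u_c, u_b]` as a bimultiplicative map. -/
noncomputable def symbolHom : C →* B →* K2 C :=
  MonoidHom.mk' (fun c => MonoidHom.mk' (symbol hC c) (symbol_mul_right hC c))
    fun c c' => MonoidHom.ext (symbol_mul_left hC c c')

theorem closure_symbol : Subgroup.closure {k | ∃ c b, symbol hC c b = k} = ⊤ := by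
  set H := Subgroup.closure {k | ∃ c b, symbol hC c b = k}
  have commutator_le : ⁅URel C, (⊤ : Subgroup (U B))⁆ ≤
      (H.comap (QuotientGroup.mk' _)).map (cycles C).subtype :=
    Subgroup.commutator_le.2 fun v hv x _ =>
      ⟨⟨_, commutator_mem_cycles_of_mem_URel hC hv x⟩,
        Subgroup.subset_closure ⟨⟨_, proj_mem_of_mem_URel hv⟩, proj B x,
          (commutatorClass_eq_symbol hC (v := ⟨v, hv⟩) rfl rfl).symm⟩, rfl⟩
  refine eq_top_iff.2 fun k _ => ?_
  obtain ⟨z, rfl⟩ := QuotientGroup.mk_surjective k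
  obtain ⟨w, hw, hwz⟩ := commutator_le z.2.2
  obtain rfl : w = z := Subtype.ext hwz
  exact hw

end Central

end K2

end KJ

theorem lemma17 {B : Type*} [Group B] (C : Subgroup B) (hC : C ≤ Subgroup.center B) :
    haveI : C.Normal := KJ.normal_of_central hC
    letI : CommGroup C := KJ.commGroupOfCentral hC
    -- the surjection `C ⊗ B^ab → K^J_2(C, B)` and its kernel
    (∃ φ : Additive C ⊗[ℤ] Additive (Abelianization B) →+ Additive (KJ.K2 C),
      (∀ (c : C) (b : B),
        φ (Additive.ofMul c ⊗ₜ[ℤ] Additive.ofMul (Abelianization.of b)) =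
          Additive.ofMul (KJ.symbol hC c b)) ∧
      Function.Surjective φ ∧
      φ.ker = AddSubgroup.closure (Set.range fun c : C =>
        Additive.ofMul c ⊗ₜ[ℤ] Additive.ofMul (Abelianization.of (c : B)))) ∧
    -- the surjection `K^J_2(C, B) → C ⊗ (B/C)^ab`
    (∃ ψ : Additive (KJ.K2 C) →+ Additive C ⊗[ℤ] Additive (Abelianization (B ⧸ C)),
      (∀ (c : C) (b : B),
        ψ (Additive.ofMul (KJ.symbol hC c b)) =
          Additive.ofMul c ⊗ₜ[ℤ] Additive.ofMul (Abelianization.of (b : B ⧸ C))) ∧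
      Function.Surjective ψ) := by
  have : C.Normal := KJ.normal_of_central hC
  let _ : CommGroup C := KJ.commGroupOfCentral hC
  set R := AddSubgroup.closure (Set.range fun c : C =>
    (Additive.ofMul c ⊗ₜ[ℤ] Additive.ofMul (Abelianization.of (c : B)) :
      Additive C ⊗[ℤ] Additive (Abelianization B)))
  let φ := KJ.tensorLift (KJ.symbolHom hC)
  have R_le : R ≤ φ.ker := by
    rw [AddSubgroup.closure_le]
    rintro _ ⟨c, rfl⟩
    exact congrArg Additive.ofMul (KJ.symbol_self hC c)
  obtain ⟨f, hf⟩ := KJ.exists_hom_symbol_eq hC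
    ((KJ.tmulHom C B).compr₂ (QuotientAddGroup.mk' R).toMultiplicative) fun c =>
      congrArg Multiplicative.ofAdd
        ((QuotientAddGroup.eq_zero_iff _).2 (AddSubgroup.subset_closure ⟨c, rfl⟩))
  obtain ⟨g, hg⟩ := KJ.exists_hom_symbol_eq hC
    ((KJ.tmulHom C (B ⧸ C)).compl₂ (QuotientGroup.mk' C)) fun c => by
      rw [MonoidHom.compl₂_apply, QuotientGroup.mk'_apply, (QuotientGroup.eq_one_iff _).2 c.2,
        map_one]
  refine ⟨⟨φ, fun _ _ => rfl, KJ.tensorLift_surjective (KJ.closure_symbol hC),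
    KJ.ker_tensorLift R_le f hf⟩, g.toAdditiveLeft, hg, AddMonoidHom.range_eq_top.1 ?_⟩
  refine KJ.addSubgroup_eq_top_of_tmul_mem fun c q => ?_
  obtain ⟨b, rfl⟩ := QuotientGroup.mk_surjective q
  exact ⟨_, hg c b⟩
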